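/- \textbf{Corollary (Encoder Non-Invertibility).} Let $D, E$ be natural numbers with $E < D$, and let $f : \mathbb{R}^D \to \mathbb{R}^E$ be continuous. Then for every nonempty open set $U \subseteq \mathbb{R}^D$, the restriction $f|_U$ is not injective; equivalently, $f|_U : U \to f(U)$ is not a bijection onto its image. Consequently, $f$ has no inverse on any nonempty open region of its domain: there is no function $g : \mathbb{R}^E \to \mathbb{R}^D$ such that $g(f(x)) = x$ for all $x \in U$ and $f(g(y)) = y$ for all $y \in f(U)$. -/

import Mathlib

open MeasureTheory Metric Set Filter Topology Module

/-! If `f` were injective on a closed ball, Tietze would extend its inverse there to a map `H`. A C¹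
approximation `P` of `H` has a range with dense complement, for dimension reasons, so `P ∘ f - c`
has no zero for some tiny `c`, though it is near the identity on the ball. Such a map yields a C¹
retraction `F` onto the sphere. None exists (`not_contDiff_retraction_sphere`): the Jacobian
integral of `(1 - t) x + t F x` over the ball is polynomial in `t` and equals the volume for small
`t ≥ 0`, yet vanishes at `t = 1`. -/

/-- The function `t ↦ det (1 + t A)` is a polynomial of degree at most the dimension. -/
theorem ContinuousLinearMap.exists_polynomial_eval_eq_det_one_add_smul
    {V : Type*} [NormedAddCommGroup V] [NormedSpace ℝ V] [FiniteDimensional ℝ V] (A : V →L[ℝ] V) :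
    ∃ p : Polynomial ℝ, p.natDegree ≤ finrank ℝ V ∧
      ∀ t : ℝ, p.eval t = (ContinuousLinearMap.id ℝ V + t • A).det := by
  let b := finBasis ℝ V
  let M := LinearMap.toMatrix b b (A : V →ₗ[ℝ] V)
  refine ⟨((Polynomial.X : Polynomial ℝ) • M.map Polynomial.C +
    (1 : Matrix _ _ ℝ).map Polynomial.C).det, ?_, fun t => ?_⟩
  · simpa using Polynomial.natDegree_det_X_add_C_le M 1
  · have h1 : (ContinuousLinearMap.id ℝ V + t • A).det = (1 + t • M).det := by
      rw [ContinuousLinearMap.det, ← LinearMap.det_toMatrix b]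
      simp [M]
    rw [h1, ← Polynomial.coe_evalRingHom, RingHom.map_det]
    congr 1
    ext i j
    by_cases h : i = j
    · subst h; simp [add_comm, mul_comm t]
    · simp [h, mul_comm t]

/-- A function that is Lipschitz on the closed unit ball and vanishes on the unit sphere remains
Lipschitz when extended by zero. -/
theorem LipschitzOnWith.indicator_closedBall
    {V W : Type*} [NormedAddCommGroup V] [NormedSpace ℝ V] [NormedAddCommGroup W]
    {u : V → W} {K : NNReal} (hu : LipschitzOnWith K u (closedBall 0 1))
    (h0 : ∀ x, ‖x‖ = 1 → u x = 0) :
    LipschitzWith K ((closedBall (0 : V) 1).indicator u) := by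
  have key : ∀ x ∈ closedBall (0 : V) 1, ∀ y ∉ closedBall (0 : V) 1,
      dist (u x) 0 ≤ K * dist x y := by
    intro x hx y hy
    simp only [mem_closedBall, dist_zero_right, not_le] at hx hy
    have hcont : ContinuousOn (fun s : ℝ => ‖AffineMap.lineMap x y s‖) (Icc 0 1) := by
      have : Continuous (fun s : ℝ => (AffineMap.lineMap x y s : V)) := AffineMap.lineMap_continuous
      fun_prop
    -- The segment from `x` to `y` crosses the unit sphere, where `u` vanishes.
    obtain ⟨s, hs, hs1⟩ := intermediate_value_Icc (zero_le_one' ℝ) hcont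
      (show (1 : ℝ) ∈ Icc _ _ by simpa using ⟨hx, hy.le⟩)
    have hz := hu.dist_le_mul x (by simpa using hx) (AffineMap.lineMap x y s)
      (by simpa using hs1.le)
    rw [h0 _ hs1, dist_left_lineMap, Real.norm_of_nonneg hs.1] at hz
    refine hz.trans ?_
    gcongr
    exact mul_le_of_le_one_left dist_nonneg hs.2
  refine LipschitzWith.of_dist_le_mul fun x y => ?_
  by_cases hx : x ∈ closedBall (0 : V) 1 <;> by_cases hy : y ∈ closedBall (0 : V) 1
  · simpa only [indicator_of_mem hx, indicator_of_mem hy] using hu.dist_le_mul x hx y hy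
  · simpa only [indicator_of_mem hx, indicator_of_notMem hy] using key x hx y hy
  · rw [indicator_of_notMem hx, indicator_of_mem hy, dist_comm, dist_comm x]
    exact key y hy x hx
  · rw [indicator_of_notMem hx, indicator_of_notMem hy, dist_self]
    positivity

/-- A small Lipschitz perturbation of the identity is bijective. -/
theorem LipschitzWith.bijective_id_add_smul
    {V : Type*} [NormedAddCommGroup V] [NormedSpace ℝ V] [CompleteSpace V]
    {u : V → V} {K : NNReal} (hu : LipschitzWith K u) {t : ℝ} (ht : 0 ≤ t) (htK : t * K < 1) :
    Function.Bijective fun x => x + t • u x := by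
  lift t to NNReal using ht
  have happ : ApproximatesLinearOn (fun x => x + (t : ℝ) • u x)
      ((ContinuousLinearEquiv.refl ℝ V : V ≃L[ℝ] V) : V →L[ℝ] V) univ (t * K) := by
    intro x _ y _
    have : x + (t : ℝ) • u x - (y + (t : ℝ) • u y) -
        ((ContinuousLinearEquiv.refl ℝ V : V ≃L[ℝ] V) : V →L[ℝ] V) (x - y) =
        (t : ℝ) • (u x - u y) := by
      simp only [ContinuousLinearEquiv.coe_refl, ContinuousLinearMap.coe_id', id_eq, smul_sub]
      abel
    rw [this, norm_smul, Real.norm_of_nonneg t.coe_nonneg, NNReal.coe_mul, mul_assoc]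
    gcongr
    exact hu.norm_sub_le x y
  have hc : Subsingleton V ∨ t * K <
      ‖((ContinuousLinearEquiv.refl ℝ V).symm : V →L[ℝ] V)‖₊⁻¹ := by
    rcases subsingleton_or_nontrivial V with h | h
    · exact Or.inl h
    · right
      have : ‖((ContinuousLinearEquiv.refl ℝ V).symm : V →L[ℝ] V)‖₊ = 1 := by
        simp
      rw [this, inv_one]
      exact_mod_cast htK
  exact ⟨injOn_univ.1 (happ.injOn hc), happ.surjective hc⟩

section Retraction

variable {V : Type*} [NormedAddCommGroup V] [InnerProductSpace ℝ V] [FiniteDimensional ℝ V]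
  [MeasurableSpace V] [BorelSpace V]

/-- The straight-line homotopy from the identity to a `C¹` self-map of the unit ball fixing the
sphere preserves, for small times, the signed volume of the ball. -/
theorem eventually_integral_det_eq_volume {F : V → V} (hF : ContDiff ℝ 1 F)
    (hF1 : ∀ x, ‖x‖ ≤ 1 → ‖F x‖ ≤ 1) (hFs : ∀ x, ‖x‖ = 1 → F x = x) :
    ∀ᶠ t in 𝓝[≥] (0 : ℝ), ∫ x in closedBall (0 : V) 1,
      (ContinuousLinearMap.id ℝ V + t • (fderiv ℝ F x - ContinuousLinearMap.id ℝ V)).det =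
        volume.real (closedBall (0 : V) 1) := by
  set u : V → V := fun x => F x - x with hu
  have huC : ContDiff ℝ 1 u := hF.sub contDiff_id
  have hud : ∀ x, HasFDerivAt u (fderiv ℝ F x - ContinuousLinearMap.id ℝ V) x := fun x =>
    ((hF.differentiable one_ne_zero) x).hasFDerivAt.sub (hasFDerivAt_id x)
  have hcompact : IsCompact (closedBall (0 : V) 1) := isCompact_closedBall _ _
  obtain ⟨K, hK⟩ := (huC.locallyLipschitz.locallyLipschitzOn
    (s := closedBall (0 : V) 1)).exists_lipschitzOnWith_of_compact hcompact
  have hLip := hK.indicator_closedBall (fun x hx => by simp [hu, hFs x hx])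
  have hpos : ∀ᶠ t in 𝓝 (0 : ℝ), ∀ x ∈ closedBall (0 : V) 1, 0 <
      (ContinuousLinearMap.id ℝ V + t • (fderiv ℝ F x - ContinuousLinearMap.id ℝ V)).det := by
    refine hcompact.eventually_forall_of_forall_eventually fun x _ => ?_
    have hc : Continuous fun z : ℝ × V => (ContinuousLinearMap.id ℝ V +
        z.1 • (fderiv ℝ F z.2 - ContinuousLinearMap.id ℝ V)).det := by
      have := hF.continuous_fderiv one_ne_zero
      exact ContinuousLinearMap.continuous_det.comp (by fun_prop)
    refine hc.continuousAt.eventually (lt_mem_nhds ?_)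
    simp [ContinuousLinearMap.det]
  have hsmall : ∀ᶠ t : ℝ in 𝓝 0, t * (K : ℝ) < 1 :=
    (continuous_mul_const (K : ℝ)).continuousAt.eventually (gt_mem_nhds (by simp))
  filter_upwards [self_mem_nhdsWithin, nhdsWithin_le_nhds hpos, nhdsWithin_le_nhds hsmall,
    nhdsWithin_le_nhds (gt_mem_nhds (zero_lt_one' ℝ))] with t ht htpos htK ht1
  have hbij := hLip.bijective_id_add_smul ht htK
  have heq : EqOn (fun x => x + t • (closedBall (0 : V) 1).indicator u x)
      (fun x => x + t • u x) (closedBall 0 1) := fun x hx => by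
    simp only [indicator_of_mem hx]
  have hinj : InjOn (fun x => x + t • u x) (closedBall 0 1) :=
    (hbij.1.injOn).congr heq
  have himage : (fun x => x + t • u x) '' closedBall 0 1 = closedBall 0 1 := by
    apply Subset.antisymm
    · rintro _ ⟨x, hx, rfl⟩
      have hx' : ‖x‖ ≤ 1 := by simpa using hx
      have : x + t • u x = (1 - t) • x + t • F x := by
        simp only [hu, smul_sub, sub_smul, one_smul]; abel
      simp only [this]
      exact convex_closedBall (0 : V) 1 hx (by simpa using hF1 x hx') (sub_nonneg.2 ht1.le) ht
        (by ring)
    -- The extended map is onto and fixes every point outside the ball, so preimages of ball points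
    -- lie in the ball.
    · intro y hy
      obtain ⟨x, hx⟩ := hbij.2 y
      by_cases hxB : x ∈ closedBall (0 : V) 1
      · exact ⟨x, hxB, (heq hxB).symm.trans hx⟩
      · simp only [indicator_of_notMem hxB, smul_zero, add_zero] at hx
        exact absurd (hx ▸ hy) hxB
  have hcov := integral_image_eq_integral_abs_det_fderiv_smul volume
    (isClosed_closedBall (x := (0 : V)) (ε := 1)).measurableSet
    (fun x _ => ((hasFDerivAt_id x).add ((hud x).const_smul t)).hasFDerivWithinAt) hinj
    (fun _ => (1 : ℝ))
  rw [show (id + t • u) '' closedBall 0 1 = closedBall 0 1 from himage] at hcov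
  simp only [smul_eq_mul, mul_one, integral_const, MeasurableSet.univ, measureReal_restrict_apply,
    univ_inter] at hcov
  rw [hcov]
  refine setIntegral_congr_fun isClosed_closedBall.measurableSet fun x hx => ?_
  exact (abs_of_pos (htpos x hx)).symm

/-- There is no `C¹` retraction of the unit ball onto the unit sphere. -/
theorem not_contDiff_retraction_sphere [Nontrivial V] {F : V → V} (hF : ContDiff ℝ 1 F)
    (hF1 : ∀ x, ‖F x‖ = 1) (hFs : ∀ x, ‖x‖ = 1 → F x = x) : False := by
  obtain ⟨ε, hε, hεI⟩ := mem_nhdsGE_iff_exists_Icc_subset.1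
    (eventually_integral_det_eq_volume hF (fun x _ => (hF1 x).le) hFs)
  set δ : V → ℝ → ℝ := fun x t =>
    (ContinuousLinearMap.id ℝ V + t • (fderiv ℝ F x - ContinuousLinearMap.id ℝ V)).det with hδ
  -- Since `‖F‖ = 1`, the range of the derivative is orthogonal to `F x ≠ 0`.
  have hdet : ∀ x, δ x 1 = 0 := by
    intro x
    by_contra hne
    have h1 : δ x 1 = (fderiv ℝ F x).det := by simp [hδ]
    rw [h1] at hne
    obtain ⟨v, hv⟩ := (LinearMap.equivOfDetNeZero _ hne).surjective (F x)
    have hd := ((hF.differentiable one_ne_zero) x).hasFDerivAt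
    have h2 := hd.inner ℝ hd
    have h3 : (fun y => inner ℝ (F y) (F y)) = fun _ => (1 : ℝ) := by
      funext y; simp [hF1 y]
    rw [h3] at h2
    have h4 := congrArg (fun L => L v) (h2.unique (hasFDerivAt_const (1 : ℝ) x))
    have hv' : fderiv ℝ F x v = F x := hv
    simp [hv', fderivInnerCLM_apply, hF1 x] at h4
  set s := Finset.range (finrank ℝ V + 1) with hs
  -- With degree at most `finrank`, `finrank + 1` nodes in `[0, ε]` determine the value at `1`.
  set c : ℕ → ℝ := fun i => ε * (i / (finrank ℝ V + 1)) with hc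
  have hε' : (0 : ℝ) < ε := hε
  have hcinj : InjOn c s := by
    intro i _ j _ hij
    have hn : (finrank ℝ V : ℝ) + 1 ≠ 0 := by positivity
    simp only [hc] at hij
    have := mul_left_cancel₀ hε'.ne' hij
    rw [div_left_inj' hn] at this
    exact_mod_cast this
  have hcmem : ∀ i ∈ s, c i ∈ Icc 0 ε := by
    intro i hi
    have hi' : (i : ℝ) ≤ finrank ℝ V + 1 := by exact_mod_cast (Finset.mem_range.1 hi).le
    refine ⟨by positivity, mul_le_of_le_one_right hε'.le ?_⟩
    exact div_le_one_of_le₀ hi' (by positivity)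
  have hlag : ∀ x, δ x 1 = ∑ i ∈ s, δ x (c i) * (Lagrange.basis s c i).eval 1 := by
    intro x
    obtain ⟨p, hp, hpe⟩ :=
      (fderiv ℝ F x - ContinuousLinearMap.id ℝ V).exists_polynomial_eval_eq_det_one_add_smul
    have hdeg : p.degree < s.card := by
      refine Polynomial.degree_le_natDegree.trans_lt ?_
      rw [hs, Finset.card_range]
      exact_mod_cast Nat.lt_succ_of_le hp
    have h := congrArg (Polynomial.eval 1) (Lagrange.eq_interpolate hcinj hdeg)
    rw [Lagrange.interpolate_apply, Polynomial.eval_finsetSum] at h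
    simpa only [hδ, ← hpe, Polynomial.eval_mul, Polynomial.eval_C] using h
  have hint : ∀ t, IntegrableOn (fun x => δ x t) (closedBall 0 1) := by
    intro t
    refine ContinuousOn.integrableOn_compact (isCompact_closedBall _ _) (Continuous.continuousOn ?_)
    have := hF.continuous_fderiv one_ne_zero
    exact ContinuousLinearMap.continuous_det.comp (by fun_prop)
  have hbasis : ∑ i ∈ s, (Lagrange.basis s c i).eval 1 = 1 := by
    rw [← Polynomial.eval_finsetSum, Lagrange.sum_basis hcinj ⟨0, by simp [hs]⟩,
      Polynomial.eval_one]
  have hzero : (0 : ℝ) = volume.real (closedBall (0 : V) 1) := by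
    calc (0 : ℝ) = ∫ x in closedBall (0 : V) 1, δ x 1 := by simp [hdet]
      _ = ∑ i ∈ s, ∫ x in closedBall (0 : V) 1,
            δ x (c i) * (Lagrange.basis s c i).eval 1 := by
          simp only [hlag]
          exact integral_finsetSum _ fun i _ => (hint (c i)).mul_const _
      _ = ∑ i ∈ s, volume.real (closedBall (0 : V) 1) * (Lagrange.basis s c i).eval 1 := by
          refine Finset.sum_congr rfl fun i hi => ?_
          rw [integral_mul_const]
          congr 1
          exact hεI (hcmem i hi)
      _ = volume.real (closedBall (0 : V) 1) := by rw [← Finset.mul_sum, hbasis, mul_one]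
  have hpos : 0 < volume.real (closedBall (0 : V) 1) :=
    ENNReal.toReal_pos (measure_closedBall_pos _ _ one_pos).ne' measure_closedBall_lt_top.ne
  exact hpos.ne hzero

/-- A continuous map that is close to the identity on the closed unit ball has a zero there. -/
theorem exists_eq_zero_of_norm_sub_le [Nontrivial V] {G : V → V} (hG : Continuous G)
    (hGid : ∀ x, ‖x‖ ≤ 1 → ‖G x - x‖ ≤ 1 / 4) : ∃ x, ‖x‖ ≤ 1 ∧ G x = 0 := by
  by_contra! hne
  obtain ⟨x₀, hx₀, hmin⟩ := (isCompact_closedBall (0 : V) 1).exists_isMinOn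
    ⟨0, by simp⟩ hG.norm.continuousOn
  have hx₀' : ‖x₀‖ ≤ 1 := by simpa using hx₀
  -- The first bound keeps `Q` nonzero on the ball; the second gives `1/4 + 1/8 < 1/2`.
  have hm : 0 < min ‖G x₀‖ (1 / 8) := lt_min (norm_pos_iff.2 (hne x₀ hx₀')) (by norm_num)
  obtain ⟨Q, hQ, hQG, -⟩ := hG.exists_contDiff_approx 1
    (ε := fun _ => min ‖G x₀‖ (1 / 8)) continuous_const (fun _ => hm)
  simp only [dist_eq_norm] at hQG
  have hQne : ∀ x, ‖x‖ ≤ 1 → Q x ≠ 0 := by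
    intro x hx h0
    have h1 := (hQG x).trans_le (min_le_left _ _)
    rw [h0, zero_sub, norm_neg] at h1
    exact absurd (hmin (show x ∈ closedBall (0 : V) 1 by simpa using hx)) (not_le.2 h1)
  have hQid : ∀ x, ‖x‖ ≤ 1 → ‖Q x - x‖ < 1 / 2 := by
    intro x hx
    have h1 := (hQG x).trans_le (min_le_right _ _)
    have h2 := hGid x hx
    have h3 := norm_add_le (Q x - G x) (G x - x)
    rw [sub_add_sub_cancel] at h3
    linarith
  -- `W` is `Q` for `‖x‖ ≤ 1/2` and the identity for `‖x‖ ≥ 1`; in between, the correction has norm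
  -- below `1/2 < ‖x‖`.
  let χ : ContDiffBump (0 : V) := ⟨1 / 2, 1, by norm_num, by norm_num⟩
  set W : V → V := fun x => x + χ x • (Q x - x) with hW
  have hWC : ContDiff ℝ 1 W :=
    contDiff_id.add (χ.contDiff.smul (hQ.sub contDiff_id))
  have hWs : ∀ x, 1 ≤ ‖x‖ → W x = x := by
    intro x hx
    have : χ x = 0 := χ.zero_of_le_dist (by simpa using hx)
    simp [hW, this]
  have hWne : ∀ x, W x ≠ 0 := by
    intro x h0
    rcases le_or_gt 1 ‖x‖ with hx | hx
    · rw [hWs x hx] at h0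
      simp [h0] at hx
      linarith
    · rcases le_or_gt ‖x‖ (1 / 2) with hx2 | hx2
      · have : χ x = 1 := χ.one_of_mem_closedBall (by simpa [χ] using hx2)
        exact hQne x hx.le (by simpa [hW, this] using h0)
      · have h1 : ‖x‖ = ‖χ x • (Q x - x)‖ := by
          simpa only [norm_neg] using congrArg norm (eq_neg_of_add_eq_zero_left h0)
        rw [norm_smul, Real.norm_of_nonneg χ.nonneg] at h1
        have h2 := mul_le_mul_of_nonneg_right (χ.le_one (x := x)) (norm_nonneg (Q x - x))
        linarith [hQid x hx.le]
  refine not_contDiff_retraction_sphere (F := fun x => ‖W x‖⁻¹ • W x)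
    (((hWC.norm ℝ hWne).inv fun x => norm_ne_zero_iff.2 (hWne x)).smul hWC) (fun x => ?_)
    (fun x hx => ?_)
  · exact norm_smul_inv_norm (𝕜 := ℝ) (hWne x)
  · simp [hWs x hx.ge, hx]

end Retraction

/-- A continuous map to a space of smaller dimension is not injective on the closed unit ball. -/
theorem Continuous.not_injOn_closedBall_of_finrank_lt
    {V W : Type*} [NormedAddCommGroup V] [InnerProductSpace ℝ V] [FiniteDimensional ℝ V]
    [NormedAddCommGroup W] [NormedSpace ℝ W] [FiniteDimensional ℝ W]
    (hVW : finrank ℝ W < finrank ℝ V) {f : V → W} (hf : Continuous f) :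
    ¬ InjOn f (closedBall 0 1) := by
  intro hinj
  let _ : MeasurableSpace V := borel V
  have : BorelSpace V := ⟨rfl⟩
  have : Nontrivial V := nontrivial_of_finrank_pos (R := ℝ) (by omega)
  have : CompactSpace (closedBall (0 : V) 1) :=
    isCompact_iff_compactSpace.1 (isCompact_closedBall _ _)
  have hemb : IsClosedEmbedding ((closedBall (0 : V) 1).domRestrict f) :=
    (hf.continuousOn.domRestrict).isClosedEmbedding hinj.injective
  let e := (stdOrthonormalBasis ℝ V).toBasis.equivFunL
  have : TietzeExtension.{_, _} V := TietzeExtension.of_homeo e.toHomeomorph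
  obtain ⟨H, hH⟩ := ContinuousMap.exists_extension' hemb
    (⟨Subtype.val, continuous_subtype_val⟩ : C(closedBall (0 : V) 1, V))
  obtain ⟨P, hP, hPH, -⟩ := H.continuous.exists_contDiff_approx 1
    (ε := fun _ => 1 / 8) continuous_const (fun _ => by norm_num)
  -- The two errors of `1/8` add up to the allowed `1/4`.
  obtain ⟨c, hc, hc8⟩ := (hP.dense_compl_range_of_finrank_lt_finrank hVW).exists_dist_lt 0
    (show (0 : ℝ) < 1 / 8 by norm_num)
  obtain ⟨x, -, hx⟩ := exists_eq_zero_of_norm_sub_le (G := fun x => P (f x) - c)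
    ((hP.continuous.comp hf).sub continuous_const) (fun x hx => by
      have h1 : H (f x) = x := congrFun hH ⟨x, by simpa using hx⟩
      have h2 := hPH (f x)
      rw [h1, dist_eq_norm] at h2
      rw [dist_zero_left] at hc8
      have h3 := norm_sub_le (P (f x) - x) c
      rw [sub_right_comm] at h3
      linarith)
  exact hc ⟨f x, sub_eq_zero.1 hx⟩

theorem Continuous.not_injOn_of_isOpen_of_finrank_lt
    {V W : Type*} [NormedAddCommGroup V] [InnerProductSpace ℝ V] [FiniteDimensional ℝ V]
    [NormedAddCommGroup W] [NormedSpace ℝ W] [FiniteDimensional ℝ W]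
    (hVW : finrank ℝ W < finrank ℝ V) {f : V → W} (hf : Continuous f)
    {U : Set V} (hU : IsOpen U) (hne : U.Nonempty) : ¬ InjOn f U := by
  intro hinj
  obtain ⟨a, ha⟩ := hne
  obtain ⟨r, hr, hrU⟩ := nhds_basis_closedBall.mem_iff.1 (hU.mem_nhds ha)
  refine (hf.comp (by fun_prop : Continuous fun x : V => a + r • x)).not_injOn_closedBall_of_finrank_lt
    hVW fun x hx y hy hxy => ?_
  have hmem : ∀ z ∈ closedBall (0 : V) 1, a + r • z ∈ U := by
    intro z hz
    apply hrU
    have hz' : ‖z‖ ≤ 1 := by simpa using hz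
    simpa [norm_smul, abs_of_pos hr] using mul_le_of_le_one_right hr.le hz'
  exact smul_right_injective V hr.ne' (add_left_cancel (hinj (hmem x hx) (hmem y hy) hxy))

theorem mainTheorem2 (D E : ℕ) (hED : E < D)
    (f : EuclideanSpace ℝ (Fin D) → EuclideanSpace ℝ (Fin E)) (hf : Continuous f)
    (U : Set (EuclideanSpace ℝ (Fin D))) (hU : IsOpen U) (hne : U.Nonempty) :
    ¬ Set.InjOn f U ∧
    ¬ Set.BijOn f U (f '' U) ∧
    ¬ ∃ g : EuclideanSpace ℝ (Fin E) → EuclideanSpace ℝ (Fin D),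
        Set.InvOn g f U (f '' U) := by
  have h : ¬ Set.InjOn f U := hf.not_injOn_of_isOpen_of_finrank_lt (by simpa using hED) hU hne
  exact ⟨h, fun hb => h hb.injOn, fun ⟨_, hg⟩ => h hg.1.injOn⟩
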